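/- Fix an interval $I_0=[a,a+r)$, $r>0$, and let $\mathcal D$ be the dyadic lattice on $\mathbb R$ with root $I_0$, i.e. the family of all intervals $\big[a+k2^{-n}r,\;a+(k+1)2^{-n}r\big)$, $n,k\in\mathbb Z$. For $I\in\mathcal D$ let $\mathcal D(I)=\{J\in\mathcal D: J\subseteq I\}$, and let $J^-,J^+$ be the left and right halves of $J\in\mathcal D$. A weight is a locally integrable function $w$ on $\mathbb R$ that is positive almost everywhere. Write $$\langle g\rangle_J=\frac1{|J|}\int_J g,\qquad \Delta_J g=\langle g\rangle_{J^-}-\langle g\rangle_{J^+},\qquad [w]_{A_2^d}=\sup_{J\in\mathcal D}\langle w\rangle_J\langle w^{-1}\rangle_J .$$ Let $\Phi$ be a non-negative function on $[1,\infty)$, and let $h(s)=\Phi(s^2)/s^2$ for $s\ge 1$. For a weight $w$ with $[w]_{A_2^d}<\infty$ and $J\in\mathcal D$ put $$c_J^\Phi(w)=|J|\,\Phi\big(\langle w\rangle_J\langle w^{-1}\rangle_J\big)\left[\frac{(\Delta_Jw)^2}{\langle w\rangle_J^2}+\frac{(\Delta_Jw^{-1})^2}{\langle w^{-1}\rangle_J^2}\right],\qquad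 \big\|\{c_J^\Phi(w)\}\big\|_{\mathcal C}=\sup_{I\in\mathcal D}\frac1{|I|}\sum_{J\in\mathcal D(I)}c_J^\Phi(w)\in[0,\infty],$$ and for $Q\ge 1$ put $$k_\Phi(Q)=\inf\Big\{\big\|\{c_J^\Phi(w)\}\big\|_{\mathcal C}:\ w\text{ a weight with }[w]_{A_2^d}=Q\Big\}.$$ **Theorem.** 1. If $h$ is increasing (not necessarily strictly) on $[1,\infty)$, then for all $Q\ge1$, $\displaystyle k_\Phi(Q)=8\int_1^Q\frac{\Phi(y)}{y}\,dy.$ 2. If $h$ is decreasing (not necessarily strictly) on $[1,\infty)$, then for all $Q\ge1$, $\displaystyle k_\Phi(Q)=8\,\Phi(Q)\Big(1-\frac1Q\Big).$ -/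

import Mathlib

open MeasureTheory Set
open scoped ENNReal

/-- A dyadic lattice on the line, given by the position `origin` and the size `size` of its root
interval `[origin, origin + size)`. -/
structure DyadicLattice where
  origin : ℝ
  size : ℝ
  size_pos : 0 < size

/-- The intervals of a dyadic lattice are indexed by pairs `(n, k)`: generation and position. -/
abbrev DyadicIndex : Type := ℤ × ℤ

namespace DyadicLattice

/-- The length `|J| = 2⁻ⁿ · size` of the interval with index `J = (n, k)`. -/
noncomputable def length (D : DyadicLattice) (J : DyadicIndex) : ℝ :=
  D.size * (2 : ℝ) ^ (-J.1)

/-- The dyadic interval with index `J = (n, k)`, that is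
`[origin + k 2⁻ⁿ size, origin + (k + 1) 2⁻ⁿ size)`. Here `n` runs over all integers, so that the
lattice has intervals of arbitrarily large and of arbitrarily small length. -/
noncomputable def interval (D : DyadicLattice) (J : DyadicIndex) : Set ℝ :=
  Ico (D.origin + (J.2 : ℝ) * D.length J) (D.origin + ((J.2 : ℝ) + 1) * D.length J)

/-- The index of the left half `J⁻` of `J`. -/
def leftHalf (J : DyadicIndex) : DyadicIndex := (J.1 + 1, 2 * J.2)

/-- The index of the right half `J⁺` of `J`. -/
def rightHalf (J : DyadicIndex) : DyadicIndex := (J.1 + 1, 2 * J.2 + 1)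

/-- The set `𝒟(I)` of the dyadic subintervals of `I` (including `I` itself). -/
def sub (D : DyadicLattice) (I : DyadicIndex) : Set DyadicIndex :=
  {J | D.interval J ⊆ D.interval I}

/-- The average `⟨g⟩_J` of a real-valued function over a dyadic interval. -/
noncomputable def avg (D : DyadicLattice) (g : ℝ → ℝ) (J : DyadicIndex) : ℝ :=
  ⨍ x in D.interval J, g x

/-- `Δ_J g = ⟨g⟩_{J⁻} - ⟨g⟩_{J⁺}`. -/
noncomputable def diff (D : DyadicLattice) (g : ℝ → ℝ) (J : DyadicIndex) : ℝ :=
  D.avg g (leftHalf J) - D.avg g (rightHalf J)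

/-- The average of a non-negative function over a dyadic interval as an element of `[0, ∞]`; it is
`∞` if the function is not integrable there. -/
noncomputable def lavg (D : DyadicLattice) (g : ℝ → ℝ) (J : DyadicIndex) : ℝ≥0∞ :=
  (∫⁻ x in D.interval J, ENNReal.ofReal (g x)) / ENNReal.ofReal (D.length J)

/-- The dyadic characteristic `[w]_{A₂ᵈ} = sup_J ⟨w⟩_J ⟨w⁻¹⟩_J` of a weight, with values in
`[0, ∞]`. -/
noncomputable def a2Char (D : DyadicLattice) (w : ℝ → ℝ) : ℝ≥0∞ :=
  ⨆ J : DyadicIndex, D.lavg w J * D.lavg (fun x => (w x)⁻¹) J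

/-- The Carleson norm of a non-negative sequence indexed by the dyadic intervals: the smallest
`C ∈ [0, ∞]` with `∑_{J ∈ 𝒟(I)} c_J ≤ C |I|` for all `I`. -/
noncomputable def carlesonNorm (D : DyadicLattice) (c : DyadicIndex → ℝ) : ℝ≥0∞ :=
  ⨆ I : DyadicIndex, (∑' J : D.sub I, ENNReal.ofReal (c J)) / ENNReal.ofReal (D.length I)

/-- The sequence
`c_J^Φ(w) = |J| Φ(⟨w⟩_J ⟨w⁻¹⟩_J) [(Δ_J w)² / ⟨w⟩_J² + (Δ_J w⁻¹)² / ⟨w⁻¹⟩_J²]`. -/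
noncomputable def cSeq (D : DyadicLattice) (Φ : ℝ → ℝ) (w : ℝ → ℝ) (J : DyadicIndex) : ℝ :=
  D.length J * Φ (D.avg w J * D.avg (fun x => (w x)⁻¹) J) *
    (D.diff w J ^ 2 / D.avg w J ^ 2 +
      D.diff (fun x => (w x)⁻¹) J ^ 2 / D.avg (fun x => (w x)⁻¹) J ^ 2)

end DyadicLattice

/-- A weight on the line: a locally integrable function that is positive almost everywhere. -/
def IsWeight (w : ℝ → ℝ) : Prop :=
  LocallyIntegrable w ∧ ∀ᵐ x, 0 < w x

/-- `k_Φ(Q)`: the infimum of the Carleson norms of the sequences `c^Φ(w)` over all weights `w` with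
`[w]_{A₂ᵈ} = Q`. -/
noncomputable def lowerCarleson (D : DyadicLattice) (Φ : ℝ → ℝ) (Q : ℝ) : ℝ≥0∞ :=
  ⨅ (w : ℝ → ℝ) (_ : IsWeight w) (_ : D.a2Char w = ENNReal.ofReal Q),
    D.carlesonNorm (D.cSeq Φ w)

/-- The auxiliary function `h(s) = Φ(s²) / s²`, considered for `s ≥ 1`. -/
noncomputable def hFun (Φ : ℝ → ℝ) (s : ℝ) : ℝ := Φ (s ^ 2) / s ^ 2

/-! Write `p_J = ⟨w⟩_J ⟨w⁻¹⟩_J ∈ [1, Q]`. Lower bound: let `g` be non-negative and increasing with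
`t g(t) ≤ Φ(t)`, and let `G(t) = ∫₁ᵗ g`, which is convex. Since `p_{J⁻} + p_{J⁺} - 2 p_J = Δ_J w Δ_J
w⁻¹ / 2`, the tangent line of `G` at `p_J` (`integral_tangent_le`) and AM-GM (`neg_two_mul_le`) give
`8|J| G(p_J) ≤ c_J + 8|J⁻| G(p_{J⁻}) + 8|J⁺| G(p_{J⁺})`. On iterating, the remainder vanishes
because `p_J → 1` almost everywhere under Lebesgue differentiation. Hence the Carleson norm is at
least `8 G(p_I)` for every `I`, and `p_I` comes arbitrarily close to `Q`
(`ofReal_integral_le_carlesonNorm`).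

Upper bound: AM-GM is an equality when `w` and `w⁻¹` have opposite relative jumps. The step weights
achieve this by multiplying by `1 ± ε` on the two halves, `N` times. Their Carleson norm is at most
`8 ∑ ε² Φ(Q (1 - ε²)ⁿ)` (`lowerCarleson_le_sum`).

If `Φ(t)/t` increases, take `g = Φ(t)/t` and many small jumps: the sum is a Riemann sum of `8 ∫
Φ(y)/y`. If it decreases, take the constant `g = Φ(Q)/Q` and a single jump. -/

namespace DyadicLattice

open Filter Topology

variable (D : DyadicLattice)

/-! ### Geometry of the lattice -/

lemma length_pos (J : DyadicIndex) : 0 < D.length J := by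
  have := D.size_pos
  unfold length
  positivity

lemma length_succ (n k l : ℤ) : D.length (n + 1, k) = D.length (n, l) / 2 := by
  simp only [length, neg_add, zpow_add₀ (two_ne_zero' ℝ), zpow_neg_one]
  ring

lemma length_leftHalf (J : DyadicIndex) : D.length (leftHalf J) = D.length J / 2 :=
  D.length_succ J.1 _ J.2

lemma length_rightHalf (J : DyadicIndex) : D.length (rightHalf J) = D.length J / 2 :=
  D.length_succ J.1 _ J.2

/-- The position of the interval of generation `n` that contains `x`. -/
noncomputable def position (n : ℤ) (x : ℝ) : ℤ := ⌊(x - D.origin) / D.length (n, 0)⌋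

lemma mem_interval_iff (n k : ℤ) (x : ℝ) : x ∈ D.interval (n, k) ↔ D.position n x = k := by
  have h := D.length_pos (n, 0)
  have e : D.length (n, k) = D.length (n, 0) := rfl
  rw [position, Int.floor_eq_iff, le_div_iff₀ h, div_lt_iff₀ h, interval, mem_Ico, e]
  constructor <;> rintro ⟨h1, h2⟩ <;> constructor <;> linarith

lemma measurable_position (n : ℤ) : Measurable (D.position n) :=
  ((measurable_id.sub_const _).div_const _).floor

lemma measurableSet_interval (J : DyadicIndex) : MeasurableSet (D.interval J) :=
  measurableSet_Ico

lemma volume_interval (J : DyadicIndex) :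
    volume (D.interval J) = ENNReal.ofReal (D.length J) := by
  rw [interval, Real.volume_Ico]
  congr 1
  ring

lemma volume_interval_ne_top (J : DyadicIndex) : volume (D.interval J) ≠ ∞ := by
  simp [volume_interval]

lemma interval_eq_union (J : DyadicIndex) :
    D.interval J = D.interval (leftHalf J) ∪ D.interval (rightHalf J) := by
  have h := D.length_pos J
  ext x
  simp only [interval, mem_union, mem_Ico, length_leftHalf, length_rightHalf]
  simp only [leftHalf, rightHalf]
  push_cast
  constructor
  · rintro ⟨h1, h2⟩
    rcases lt_or_ge x (D.origin + (2 * (J.2 : ℝ) + 1) * (D.length J / 2)) with h3 | h3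
    · left; constructor <;> linarith
    · right; constructor <;> linarith
  · rintro (⟨h1, h2⟩ | ⟨h1, h2⟩) <;> constructor <;> linarith

lemma disjoint_interval (n : ℤ) {k l : ℤ} (h : k ≠ l) :
    Disjoint (D.interval (n, k)) (D.interval (n, l)) := by
  rw [Set.disjoint_left]
  intro x hx hy
  rw [mem_interval_iff] at hx hy
  exact h (hx.symm.trans hy)

lemma disjoint_halves (J : DyadicIndex) :
    Disjoint (D.interval (leftHalf J)) (D.interval (rightHalf J)) :=
  D.disjoint_interval _ (by omega)

lemma leftHalf_subset (J : DyadicIndex) : D.interval (leftHalf J) ⊆ D.interval J := by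
  rw [D.interval_eq_union J]; exact subset_union_left

lemma rightHalf_subset (J : DyadicIndex) : D.interval (rightHalf J) ⊆ D.interval J := by
  rw [D.interval_eq_union J]; exact subset_union_right

lemma eq_half (n k : ℤ) :
    ((n + 1, k) : DyadicIndex) = leftHalf (n, k / 2) ∨
      ((n + 1, k) : DyadicIndex) = rightHalf (n, k / 2) := by
  rcases Int.emod_two_eq_zero_or_one k with h | h
  · left; simp only [leftHalf, Prod.mk.injEq, true_and]; omega
  · right; simp only [rightHalf, Prod.mk.injEq, true_and]; omega

lemma interval_nonempty (J : DyadicIndex) : (D.interval J).Nonempty := by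
  have := D.length_pos J
  exact nonempty_Ico.2 (by linarith)

/-! ### Averages -/

lemma avg_eq (g : ℝ → ℝ) (J : DyadicIndex) :
    D.avg g J = (∫ x in D.interval J, g x) / D.length J := by
  rw [avg, setAverage_eq, measureReal_def, volume_interval,
    ENNReal.toReal_ofReal (D.length_pos J).le, smul_eq_mul, inv_mul_eq_div]

lemma avg_eq_halves {g : ℝ → ℝ} {J : DyadicIndex} (hg : IntegrableOn g (D.interval J)) :
    D.avg g J = (D.avg g (leftHalf J) + D.avg g (rightHalf J)) / 2 := by
  have h := D.length_pos J
  rw [avg_eq, avg_eq, avg_eq, D.interval_eq_union J,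
    setIntegral_union (D.disjoint_halves J) (D.measurableSet_interval _)
      (hg.mono_set (D.leftHalf_subset J)) (hg.mono_set (D.rightHalf_subset J)),
    length_leftHalf, length_rightHalf]
  field_simp

lemma avg_of_eqOn {g : ℝ → ℝ} {J : DyadicIndex} {c : ℝ} (h : ∀ x ∈ D.interval J, g x = c) :
    D.avg g J = c := by
  have hl := D.length_pos J
  rw [avg_eq, setIntegral_congr_fun (D.measurableSet_interval J) h, setIntegral_const,
    measureReal_def, volume_interval, ENNReal.toReal_ofReal hl.le, smul_eq_mul]
  field_simp

lemma lavg_eq_ofReal_avg {g : ℝ → ℝ} {J : DyadicIndex} (hg : IntegrableOn g (D.interval J))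
    (h0 : ∀ᵐ x, 0 ≤ g x) : D.lavg g J = ENNReal.ofReal (D.avg g J) := by
  rw [avg_eq, lavg, ENNReal.ofReal_div_of_pos (D.length_pos J),
    ofReal_integral_eq_lintegral_ofReal hg (ae_restrict_of_ae h0)]

/-- The closed ball with the same center and length as the interval `J` gives the same averages. -/
lemma avg_eq_closedBall (g : ℝ → ℝ) (J : DyadicIndex) :
    D.avg g J = ⨍ x in Metric.closedBall (D.origin + ((J.2 : ℝ) + 1 / 2) * D.length J)
      (D.length J / 2), g x := by
  have e1 : D.origin + ((J.2 : ℝ) + 1 / 2) * D.length J - D.length J / 2 =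
      D.origin + (J.2 : ℝ) * D.length J := by ring
  have e2 : D.origin + ((J.2 : ℝ) + 1 / 2) * D.length J + D.length J / 2 =
      D.origin + ((J.2 : ℝ) + 1) * D.length J := by ring
  rw [avg, Real.closedBall_eq_Icc, interval, e1, e2]
  exact setAverage_congr Ico_ae_eq_Icc

lemma tendsto_length (n : ℤ) :
    Tendsto (fun m : ℕ => D.length (n + m, 0)) atTop (𝓝[>] 0) := by
  refine tendsto_nhdsWithin_iff.2 ⟨?_, Eventually.of_forall fun m => D.length_pos _⟩
  have h : (fun m : ℕ => D.length (n + m, 0)) =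
      fun m : ℕ => D.length (n, 0) * (1 / 2 : ℝ) ^ m := by
    funext m
    simp only [length, neg_add, zpow_add₀ (two_ne_zero' ℝ)]
    simp [mul_assoc]
  rw [h]
  simpa using (tendsto_pow_atTop_nhds_zero_of_lt_one (by norm_num : (0 : ℝ) ≤ 1 / 2)
    (by norm_num)).const_mul (D.length (n, 0))

/-- Lebesgue differentiation along the dyadic intervals. -/
lemma ae_tendsto_avg {g : ℝ → ℝ} (hg : LocallyIntegrable g) (n : ℤ) :
    ∀ᵐ x, Tendsto (fun m : ℕ => D.avg g (n + m, D.position (n + m) x)) atTop (𝓝 (g x)) := by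
  -- Balls need not be centred at `x`: with dilation factor `1` they only have to contain it.
  filter_upwards [IsUnifLocDoublingMeasure.ae_tendsto_average volume hg 1] with x hx
  simp only [avg_eq_closedBall]
  refine hx _ _ ?_ (Eventually.of_forall fun m => ?_)
  · have h := (D.tendsto_length n)
    rw [tendsto_nhdsWithin_iff] at h ⊢
    exact ⟨(zero_div (2 : ℝ)) ▸ h.1.div_const 2,
      Eventually.of_forall fun m => half_pos (D.length_pos _)⟩
  · have h := (D.mem_interval_iff (n + m) _ x).2 rfl
    rw [interval, mem_Ico] at h
    rw [Real.closedBall_eq_Icc, mem_Icc]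
    constructor <;> linarith [h.1, h.2]

/-- A function that is integrable on all dyadic intervals is locally integrable. -/
lemma locallyIntegrable_of_interval {g : ℝ → ℝ} (hg : ∀ J, IntegrableOn g (D.interval J)) :
    LocallyIntegrable g := by
  intro x
  obtain ⟨m, hm⟩ := pow_unbounded_of_one_lt (|x - D.origin| / D.size) (one_lt_two (α := ℝ))
  rw [div_lt_iff₀ D.size_pos] at hm
  have hl : D.length (-(m : ℤ), 0) = 2 ^ m * D.size := by
    simp [length, mul_comm]
  have hl' : D.length (-(m : ℤ), -1) = 2 ^ m * D.size := hl
  obtain ⟨hm1, hm2⟩ := abs_lt.1 hm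
  refine ⟨_, Ico_mem_nhds (show D.origin - 2 ^ m * D.size < x by linarith)
    (show x < D.origin + 2 ^ m * D.size by linarith), ?_⟩
  -- Two intervals are needed: the origin is an endpoint at every generation, so no dyadic interval
  -- is a neighbourhood of it.
  refine ((hg (-(m : ℤ), -1)).union (hg (-(m : ℤ), 0))).mono_set ?_
  intro y hy
  simp only [interval, hl, hl', mem_union, mem_Ico] at hy ⊢
  push_cast
  rcases lt_or_ge y D.origin with h | h
  · left; constructor <;> linarith [hy.1]
  · right; constructor <;> linarith [hy.2]

/-! ### Averages of a weight and of its inverse -/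

lemma integrableOn_interval {w : ℝ → ℝ} (hw : LocallyIntegrable w) (J : DyadicIndex) :
    IntegrableOn w (D.interval J) :=
  (hw.integrableOn_isCompact isCompact_Icc).mono_set Ico_subset_Icc_self

lemma ae_restrict_neBot (J : DyadicIndex) : (ae (volume.restrict (D.interval J))).NeBot := by
  rw [ae_neBot, Ne, Measure.restrict_eq_zero, volume_interval]
  simpa using D.length_pos J

lemma avg_pos {g : ℝ → ℝ} {J : DyadicIndex} (hg : IntegrableOn g (D.interval J))
    (h0 : ∀ᵐ x, 0 < g x) : 0 < D.avg g J := by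
  have h0' : ∀ᵐ x ∂volume.restrict (D.interval J), 0 < g x := ae_restrict_of_ae h0
  have hn : 0 ≤ᵐ[volume.restrict (D.interval J)] g := h0'.mono fun x hx => hx.le
  rw [avg_eq]
  refine div_pos (lt_of_le_of_ne (integral_nonneg_of_ae hn) fun h => ?_) (D.length_pos J)
  have h1 := (integral_eq_zero_iff_of_nonneg_ae hn hg).1 h.symm
  have := D.ae_restrict_neBot J
  obtain ⟨x, hx1, hx2⟩ := (h0'.and h1).exists
  exact hx1.ne' hx2

/-- Since `⟨w⟩_J > 0`, an infinite average of `w⁻¹` would make the product infinite. -/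
lemma integrableOn_inv {w : ℝ → ℝ} (hw : IsWeight w) (hQ : D.a2Char w ≠ ∞) (J : DyadicIndex) :
    IntegrableOn (fun x => (w x)⁻¹) (D.interval J) := by
  have hi := D.integrableOn_interval hw.1 J
  have hpos := D.avg_pos hi hw.2
  have hl := D.lavg_eq_ofReal_avg hi (hw.2.mono fun x hx => hx.le)
  have hne : D.lavg w J * D.lavg (fun x => (w x)⁻¹) J ≠ ∞ :=
    ne_top_of_le_ne_top hQ
      (le_iSup (fun J => D.lavg w J * D.lavg (fun x => (w x)⁻¹) J) J)
  have h1 : D.lavg (fun x => (w x)⁻¹) J ≠ ∞ := by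
    intro h
    rw [h, hl, ENNReal.mul_top (by simpa using hpos)] at hne
    exact hne rfl
  refine ⟨hi.1.aemeasurable.inv.aestronglyMeasurable, ?_⟩
  rw [hasFiniteIntegral_iff_ofReal
    (ae_restrict_of_ae (hw.2.mono fun x hx => (inv_pos.2 hx).le))]
  rw [lavg] at h1
  refine lt_top_iff_ne_top.2 fun h => h1 ?_
  rw [h, ENNReal.top_div_of_ne_top ENNReal.ofReal_ne_top]

/-- The product `⟨w⟩_J ⟨w⁻¹⟩_J`. -/
noncomputable def avgProd (w : ℝ → ℝ) (J : DyadicIndex) : ℝ :=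
  D.avg w J * D.avg (fun x => (w x)⁻¹) J

section Weight

variable {D} {w : ℝ → ℝ} (hw : IsWeight w)
include hw

lemma inv_pos_ae : ∀ᵐ x, 0 < (w x)⁻¹ := hw.2.mono fun _ hx => inv_pos.2 hx

/-- Averaging the pointwise bound `w/X + X/w ≥ 2` over `J`, with `X = ⟨w⟩_J`, gives `1 + XY ≥ 2`. -/
lemma one_le_avgProd (hQ : D.a2Char w ≠ ∞) (J : DyadicIndex) : 1 ≤ D.avgProd w J := by
  have hi := D.integrableOn_interval hw.1 J
  have hj := D.integrableOn_inv hw hQ J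
  have hl := D.length_pos J
  have hX := D.avg_pos hi hw.2
  have hXe := D.avg_eq w J
  have hYe := D.avg_eq (fun x => (w x)⁻¹) J
  rw [avgProd]
  set X := D.avg w J
  set Y := D.avg (fun x => (w x)⁻¹) J
  have h1 : ∫ _ in D.interval J, (2 : ℝ) ≤ ∫ x in D.interval J, (X⁻¹ * w x + X * (w x)⁻¹) := by
    refine integral_mono_ae (integrableOn_const (D.volume_interval_ne_top J))
      ((hi.const_mul _).add (hj.const_mul _)) (ae_restrict_of_ae (hw.2.mono fun x hx => ?_))
    have h2 : X⁻¹ * w x + X * (w x)⁻¹ - 2 = (w x - X) ^ 2 / (X * w x) := by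
      field_simp; ring
    have h3 : 0 ≤ (w x - X) ^ 2 / (X * w x) := by positivity
    simp only
    linarith
  rw [integral_add (hi.const_mul _) (hj.const_mul _), integral_const_mul, integral_const_mul,
    setIntegral_const, measureReal_def, volume_interval, ENNReal.toReal_ofReal hl.le,
    smul_eq_mul] at h1
  rw [eq_div_iff hl.ne'] at hXe hYe
  rw [← hXe, ← hYe, ← mul_assoc, inv_mul_cancel₀ hX.ne'] at h1
  have : D.length J * 2 ≤ D.length J * (1 + X * Y) := by linarith
  have := le_of_mul_le_mul_left this hl
  linarith

lemma lavg_mul_lavg (hQ : D.a2Char w ≠ ∞) (J : DyadicIndex) :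
    D.lavg w J * D.lavg (fun x => (w x)⁻¹) J = ENNReal.ofReal (D.avgProd w J) := by
  rw [D.lavg_eq_ofReal_avg (D.integrableOn_interval hw.1 J) (hw.2.mono fun x hx => hx.le),
    D.lavg_eq_ofReal_avg (D.integrableOn_inv hw hQ J) ((inv_pos_ae hw).mono fun x hx => hx.le),
    ← ENNReal.ofReal_mul (D.avg_pos (D.integrableOn_interval hw.1 J) hw.2).le, avgProd]

lemma avgProd_le {Q : ℝ} (hQ1 : 1 ≤ Q) (hQ : D.a2Char w = ENNReal.ofReal Q) (J : DyadicIndex) :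
    D.avgProd w J ≤ Q := by
  rw [← ENNReal.ofReal_le_ofReal_iff (by linarith), ← hQ,
    ← lavg_mul_lavg hw (by simp [hQ])]
  exact le_iSup (fun J => D.lavg w J * D.lavg (fun x => (w x)⁻¹) J) J

lemma exists_lt_avgProd {Q q : ℝ} (hQ1 : 1 ≤ Q) (hQ : D.a2Char w = ENNReal.ofReal Q)
    (hq : q < Q) : ∃ J, q < D.avgProd w J := by
  by_contra! h
  have : D.a2Char w ≤ ENNReal.ofReal q := iSup_le fun J => by
    rw [lavg_mul_lavg hw (by simp [hQ])]
    exact ENNReal.ofReal_le_ofReal (h J)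
  rw [hQ] at this
  exact absurd this (not_le.2 ((ENNReal.ofReal_lt_ofReal_iff (by linarith)).2 hq))

lemma ae_tendsto_avgProd (hQ : D.a2Char w ≠ ∞) (n : ℤ) :
    ∀ᵐ x, Tendsto (fun m : ℕ => D.avgProd w (n + m, D.position (n + m) x)) atTop (𝓝 1) := by
  filter_upwards [D.ae_tendsto_avg hw.1 n,
    D.ae_tendsto_avg (D.locallyIntegrable_of_interval (D.integrableOn_inv hw hQ)) n, hw.2]
    with x h1 h2 h3
  simpa [avgProd, mul_inv_cancel₀ h3.ne'] using h1.mul h2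

end Weight

/-! ### Sums over generations -/

/-- The sum of `f` over the descendants of an interval, `n` generations down. -/
def generationSum (f : DyadicIndex → ℝ) : ℕ → DyadicIndex → ℝ
  | 0, I => f I
  | n + 1, I => generationSum f n (leftHalf I) + generationSum f n (rightHalf I)

/-- The sum of `c` over the descendants of an interval of fewer than `n` generations down. -/
def partialSum (c : DyadicIndex → ℝ) : ℕ → DyadicIndex → ℝ
  | 0, _ => 0
  | n + 1, I => c I + (partialSum c n (leftHalf I) + partialSum c n (rightHalf I))

lemma partialSum_nonneg {c : DyadicIndex → ℝ} (hc : ∀ J, 0 ≤ c J) (n : ℕ) (I : DyadicIndex) :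
    0 ≤ partialSum c n I := by
  induction n generalizing I with
  | zero => exact le_rfl
  | succ n ih => exact add_nonneg (hc I) (add_nonneg (ih _) (ih _))

lemma not_interval_subset_half {I H : DyadicIndex} (hl : D.length H = D.length I / 2) :
    ¬ D.interval I ⊆ D.interval H := by
  intro h
  have h1 := measure_mono (μ := volume) h
  have := D.length_pos I
  rw [volume_interval, volume_interval, hl, ENNReal.ofReal_le_ofReal_iff (by linarith)] at h1
  linarith

/-- `I` and the subintervals of its two halves form three disjoint subfamilies of `𝒟(I)`. They also
exhaust it, but the lower bound does not need that. -/
lemma add_tsum_halves_le (f : DyadicIndex → ℝ≥0∞) (I : DyadicIndex) :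
    f I + (∑' J : D.sub (leftHalf I), f J + ∑' J : D.sub (rightHalf I), f J) ≤
      ∑' J : D.sub I, f J := by
  have h1 : Disjoint (D.sub (leftHalf I)) (D.sub (rightHalf I)) := by
    rw [Set.disjoint_left]
    intro J hJ hJ'
    obtain ⟨x, hx⟩ := D.interval_nonempty J
    exact Set.disjoint_left.1 (D.disjoint_halves I) (hJ hx) (hJ' hx)
  have h2 : Disjoint {I} (D.sub (leftHalf I) ∪ D.sub (rightHalf I)) := by
    rw [Set.disjoint_singleton_left]
    rintro (h | h)
    · exact D.not_interval_subset_half (D.length_leftHalf I) h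
    · exact D.not_interval_subset_half (D.length_rightHalf I) h
  have h3 : {I} ∪ (D.sub (leftHalf I) ∪ D.sub (rightHalf I)) ⊆ D.sub I := by
    rintro J (rfl | h | h)
    · exact Subset.rfl
    · exact Subset.trans h (D.leftHalf_subset I)
    · exact Subset.trans h (D.rightHalf_subset I)
  calc _ = ∑' J : ↑({I} ∪ (D.sub (leftHalf I) ∪ D.sub (rightHalf I)) : Set DyadicIndex), f J := by
        rw [ENNReal.summable.tsum_union_disjoint h2 ENNReal.summable,
          ENNReal.summable.tsum_union_disjoint h1 ENNReal.summable, tsum_singleton]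
    _ ≤ _ := ENNReal.tsum_mono_subtype f h3

lemma ofReal_partialSum_le {c : DyadicIndex → ℝ} (hc : ∀ J, 0 ≤ c J) (n : ℕ) (I : DyadicIndex) :
    ENNReal.ofReal (partialSum c n I) ≤ ∑' J : D.sub I, ENNReal.ofReal (c J) := by
  induction n generalizing I with
  | zero => simp [partialSum]
  | succ n ih =>
    refine le_trans ?_ (D.add_tsum_halves_le (fun J => ENNReal.ofReal (c J)) I)
    have h1 := partialSum_nonneg hc n (leftHalf I)
    have h2 := partialSum_nonneg hc n (rightHalf I)
    rw [partialSum, ENNReal.ofReal_add (hc I) (add_nonneg h1 h2), ENNReal.ofReal_add h1 h2]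
    gcongr
    · exact ih _
    · exact ih _

lemma le_partialSum_add_generationSum {b c : DyadicIndex → ℝ}
    (h : ∀ I, b I ≤ c I + (b (leftHalf I) + b (rightHalf I))) (n : ℕ) (I : DyadicIndex) :
    b I ≤ partialSum c n I + generationSum b n I := by
  induction n generalizing I with
  | zero => simp [partialSum, generationSum]
  | succ n ih =>
    have := h I
    have := ih (leftHalf I)
    have := ih (rightHalf I)
    simp only [partialSum, generationSum]
    linarith

lemma generationSum_mono {b b' : DyadicIndex → ℝ} (h : ∀ J, b J ≤ b' J) (n : ℕ)
    (I : DyadicIndex) : generationSum b n I ≤ generationSum b' n I := by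
  induction n generalizing I with
  | zero => exact h I
  | succ n ih => exact add_le_add (ih _) (ih _)

/-- A sum over a generation is the integral of a step function. -/
lemma generationSum_length_mul {f : DyadicIndex → ℝ} {C : ℝ} (hf : ∀ J, ‖f J‖ ≤ C) (n : ℕ)
    (I : DyadicIndex) :
    generationSum (fun J => D.length J * f J) n I =
      ∫ x in D.interval I, f (I.1 + n, D.position (I.1 + n) x) := by
  induction n generalizing I with
  | zero =>
    have h : ∀ x ∈ D.interval I, f (I.1 + (0 : ℕ), D.position (I.1 + (0 : ℕ)) x) = f I := by
      intro x hx
      simp only [Nat.cast_zero, add_zero]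
      rw [(D.mem_interval_iff I.1 I.2 x).1 hx]
    rw [setIntegral_congr_fun (D.measurableSet_interval I) h, setIntegral_const,
      measureReal_def, volume_interval, ENNReal.toReal_ofReal (D.length_pos I).le, smul_eq_mul]
    rfl
  | succ n ih =>
    have hint : ∀ J m, IntegrableOn (fun x => f (m, D.position m x)) (D.interval J) := by
      intro J m
      refine Measure.integrableOn_of_bounded (M := C) (D.volume_interval_ne_top J) ?_
        (Eventually.of_forall fun x => hf _)
      exact ((Measurable.of_discrete (f := fun k : ℤ => f (m, k))).comp
        (D.measurable_position m)).aestronglyMeasurable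
    rw [generationSum, ih, ih, D.interval_eq_union I,
      setIntegral_union (D.disjoint_halves I) (D.measurableSet_interval _) (hint _ _) (hint _ _)]
    have e : I.1 + 1 + (n : ℤ) = I.1 + (n + 1 : ℕ) := by push_cast; ring
    simp only [leftHalf, rightHalf, e]

/-- The sums are integrals of step functions bounded by `Q` that tend to `0` almost everywhere, so
dominated convergence applies. -/
lemma tendsto_generationSum_avgProd {w : ℝ → ℝ} (hw : IsWeight w) {Q : ℝ} (hQ1 : 1 ≤ Q)
    (hQ : D.a2Char w = ENNReal.ofReal Q) (I : DyadicIndex) :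
    Tendsto (fun n => generationSum (fun J => D.length J * (D.avgProd w J - 1)) n I) atTop
      (𝓝 0) := by
  have hQt : D.a2Char w ≠ ∞ := by simp [hQ]
  have hb : ∀ J, ‖D.avgProd w J - 1‖ ≤ Q := fun J => by
    have h1 := one_le_avgProd hw hQt J
    have h2 := avgProd_le hw hQ1 hQ J
    rw [Real.norm_eq_abs, abs_le]
    constructor <;> linarith
  simp only [D.generationSum_length_mul hb]
  have := tendsto_integral_of_dominated_convergence (μ := volume.restrict (D.interval I))
    (F := fun n : ℕ => fun x => D.avgProd w (I.1 + n, D.position (I.1 + n) x) - 1)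
    (f := fun _ => 0) (fun _ => Q)
    (fun n => (((Measurable.of_discrete (f := fun k : ℤ => D.avgProd w (I.1 + n, k))).comp
        (D.measurable_position _)).sub_const 1).aestronglyMeasurable)
    (integrableOn_const (D.volume_interval_ne_top I))
    (fun n => Eventually.of_forall fun x => hb _)
    (ae_restrict_of_ae ((ae_tendsto_avgProd hw hQt I.1).mono fun x hx => by
      simpa using hx.sub_const 1))
  simpa using this

/-! ### The lower bound -/

/-- The primitive of an increasing function is convex, and `g t` is a subgradient at `t` even where
`g` jumps. -/
lemma integral_tangent_le {g : ℝ → ℝ} {Q s t : ℝ} (hg : MonotoneOn g (Icc 1 Q))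
    (hs : s ∈ Icc 1 Q) (ht : t ∈ Icc 1 Q) :
    (∫ y in (1 : ℝ)..t, g y) + g t * (s - t) ≤ ∫ y in (1 : ℝ)..s, g y := by
  have hi : ∀ {a b : ℝ}, a ∈ Icc 1 Q → b ∈ Icc 1 Q → IntervalIntegrable g volume a b :=
    fun ha hb => (hg.mono ((ordConnected_Icc).uIcc_subset ha hb)).intervalIntegrable
  have h1 : (1 : ℝ) ∈ Icc 1 Q := ⟨le_rfl, hs.1.trans hs.2⟩
  rw [← intervalIntegral.integral_add_adjacent_intervals (hi h1 ht) (hi ht hs)]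
  gcongr
  rcases le_total t s with h | h
  · have := intervalIntegral.integral_mono_on h intervalIntegrable_const (hi ht hs)
      (fun x hx => hg ht ⟨ht.1.trans hx.1, hx.2.trans hs.2⟩ hx.1)
    rw [intervalIntegral.integral_const, smul_eq_mul] at this
    linarith
  · have := intervalIntegral.integral_mono_on h (hi hs ht) intervalIntegrable_const
      (fun x hx => hg ⟨hs.1.trans hx.1, hx.2.trans ht.2⟩ ht hx.2)
    rw [intervalIntegral.integral_const, smul_eq_mul] at this
    rw [intervalIntegral.integral_symm]
    linarith

/-- AM-GM for `a/X` and `-b/Y`, with equality exactly when these agree; the step weights are built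
to satisfy that. -/
lemma neg_two_mul_le {X Y : ℝ} (hX : 0 < X) (hY : 0 < Y) (a b : ℝ) :
    -(2 * (a * b)) ≤ X * Y * (a ^ 2 / X ^ 2 + b ^ 2 / Y ^ 2) := by
  have h : X * Y * (a ^ 2 / X ^ 2 + b ^ 2 / Y ^ 2) + 2 * (a * b) =
      (a * Y + b * X) ^ 2 / (X * Y) := by
    field_simp; ring
  have : 0 ≤ (a * Y + b * X) ^ 2 / (X * Y) := by positivity
  linarith

/-- If `g` is increasing and `t g(t) ≤ Φ(t)` on `[1, Q]`, then the Carleson norm of the sequence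
`c^Φ(w)` is at least `8 ∫₁^Q g`. -/
theorem ofReal_integral_le_carlesonNorm {Φ g w : ℝ → ℝ} {Q : ℝ} (hQ1 : 1 ≤ Q)
    (hΦ : ∀ t, 1 ≤ t → 0 ≤ Φ t) (hg : MonotoneOn g (Icc 1 Q)) (hg0 : ∀ t ∈ Icc 1 Q, 0 ≤ g t)
    (hgΦ : ∀ t ∈ Icc 1 Q, g t * t ≤ Φ t) (hw : IsWeight w)
    (hQ : D.a2Char w = ENNReal.ofReal Q) :
    ENNReal.ofReal (8 * ∫ y in (1 : ℝ)..Q, g y) ≤ D.carlesonNorm (D.cSeq Φ w) := by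
  have hQt : D.a2Char w ≠ ∞ := by simp [hQ]
  have hm : ∀ J, D.avgProd w J ∈ Icc 1 Q := fun J =>
    ⟨one_le_avgProd hw hQt J, avgProd_le hw hQ1 hQ J⟩
  have hQm : Q ∈ Icc 1 Q := ⟨hQ1, le_rfl⟩
  have h1m : (1 : ℝ) ∈ Icc 1 Q := ⟨le_rfl, hQ1⟩
  have hgQ := hg0 Q hQm
  have hc : ∀ J, 0 ≤ D.cSeq Φ w J := fun J => by
    have h1 := hΦ _ (hm J).1
    have h2 := D.length_pos J
    rw [avgProd] at h1
    unfold cSeq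
    positivity
  set G : ℝ → ℝ := fun t => ∫ y in (1 : ℝ)..t, g y with hG
  -- The constant `8` collects three factors `2`: from averaging over the halves, from `hprod`, and
  -- from AM-GM.
  have hstep : ∀ I, D.length I * (8 * G (D.avgProd w I)) ≤ D.cSeq Φ w I +
      (D.length (leftHalf I) * (8 * G (D.avgProd w (leftHalf I))) +
        D.length (rightHalf I) * (8 * G (D.avgProd w (rightHalf I)))) := by
    intro I
    have hl := D.length_pos I
    have t1 := integral_tangent_le hg (hm (leftHalf I)) (hm I)
    have t2 := integral_tangent_le hg (hm (rightHalf I)) (hm I)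
    have hgI := hg0 _ (hm I)
    have hgΦI := hgΦ _ (hm I)
    have hX := D.avg_pos (D.integrableOn_interval hw.1 I) hw.2
    have hY := D.avg_pos (D.integrableOn_inv hw hQt I) (inv_pos_ae hw)
    have eX := D.avg_eq_halves (D.integrableOn_interval hw.1 I)
    have eY := D.avg_eq_halves (D.integrableOn_inv hw hQt I)
    have key := neg_two_mul_le hX hY (D.diff w I) (D.diff (fun x => (w x)⁻¹) I)
    have hsq : 0 ≤ D.diff w I ^ 2 / D.avg w I ^ 2 +
      D.diff (fun x => (w x)⁻¹) I ^ 2 / D.avg (fun x => (w x)⁻¹) I ^ 2 := by positivity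
    have hprod : D.avgProd w (leftHalf I) + D.avgProd w (rightHalf I) - 2 * D.avgProd w I =
        D.diff w I * D.diff (fun x => (w x)⁻¹) I / 2 := by
      simp only [avgProd, diff]
      rw [eX, eY]
      ring
    have hcI : D.cSeq Φ w I = D.length I * (Φ (D.avgProd w I) * (D.diff w I ^ 2 / D.avg w I ^ 2 +
      D.diff (fun x => (w x)⁻¹) I ^ 2 / D.avg (fun x => (w x)⁻¹) I ^ 2)) := by
      rw [cSeq, avgProd]; ring
    rw [hcI, length_leftHalf, length_rightHalf]
    have k1 := mul_le_mul_of_nonneg_left key hgI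
    have k2 := mul_le_mul_of_nonneg_right hgΦI hsq
    change _ ≤ g (D.avgProd w I) * (D.avgProd w I * _) at k1
    have k3 : g (D.avgProd w I) * (D.avgProd w (leftHalf I) + D.avgProd w (rightHalf I) -
        2 * D.avgProd w I) = g (D.avgProd w I) *
        (D.diff w I * D.diff (fun x => (w x)⁻¹) I / 2) := by rw [hprod]
    have k4 : 8 * G (D.avgProd w I) ≤ Φ (D.avgProd w I) * (D.diff w I ^ 2 / D.avg w I ^ 2 +
        D.diff (fun x => (w x)⁻¹) I ^ 2 / D.avg (fun x => (w x)⁻¹) I ^ 2) +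
        (8 * G (D.avgProd w (leftHalf I)) + 8 * G (D.avgProd w (rightHalf I))) / 2 := by
      simp only [hG]
      nlinarith [t1, t2, k1, k2, k3]
    have k5 := mul_le_mul_of_nonneg_left k4 hl.le
    linarith
  -- `G(1) = 0` and `G` has slope at most `g Q`, so the remainder is controlled by `p_J - 1`.
  have hrem : ∀ J, D.length J * (8 * G (D.avgProd w J)) ≤
      8 * g Q * (D.length J * (D.avgProd w J - 1)) := fun J => by
    have h1 : G (D.avgProd w J) ≤ g Q * (D.avgProd w J - 1) := by
      have h2 := integral_tangent_le hg h1m (hm J)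
      rw [intervalIntegral.integral_same] at h2
      have h3 := mul_le_mul_of_nonneg_right (hg (hm J) hQm (hm J).2) (sub_nonneg.2 (hm J).1)
      simp only [hG]
      linarith
    have := mul_le_mul_of_nonneg_left h1 (D.length_pos J).le
    linarith
  have hgs : ∀ (a : ℝ) (f : DyadicIndex → ℝ) (n : ℕ) (I : DyadicIndex),
      generationSum (fun J => a * f J) n I = a * generationSum f n I := by
    intro a f n
    induction n with
    | zero => intro I; rfl
    | succ n ih => intro I; simp only [generationSum, ih, mul_add]
  have hlow : ∀ I, ENNReal.ofReal (8 * G (D.avgProd w I)) ≤ D.carlesonNorm (D.cSeq Φ w) := by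
    intro I
    have hl := D.length_pos I
    have hlim : Tendsto (fun n => ENNReal.ofReal (D.length I * (8 * G (D.avgProd w I)) -
        8 * g Q * generationSum (fun J => D.length J * (D.avgProd w J - 1)) n I)) atTop
        (𝓝 (ENNReal.ofReal (D.length I * (8 * G (D.avgProd w I))))) := by
      refine ENNReal.tendsto_ofReal ?_
      simpa using ((D.tendsto_generationSum_avgProd hw hQ1 hQ I).const_mul (8 * g Q)).const_sub
        (D.length I * (8 * G (D.avgProd w I)))
    have hT : ENNReal.ofReal (D.length I * (8 * G (D.avgProd w I))) ≤
        ∑' J : D.sub I, ENNReal.ofReal (D.cSeq Φ w J) := by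
      refine le_of_tendsto' hlim fun n => le_trans (ENNReal.ofReal_le_ofReal ?_)
        (D.ofReal_partialSum_le hc n I)
      have h1 := le_partialSum_add_generationSum hstep n I
      have h2 := generationSum_mono hrem n I
      rw [hgs] at h2
      linarith
    refine le_trans ?_ (le_iSup (fun I => (∑' J : D.sub I, ENNReal.ofReal (D.cSeq Φ w J)) /
      ENNReal.ofReal (D.length I)) I)
    rw [ENNReal.le_div_iff_mul_le (by simp [hl]) (by simp), mul_comm,
      ← ENNReal.ofReal_mul hl.le]
    exact hT
  refine ENNReal.le_of_forall_pos_le_add fun ε hε _ => ?_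
  -- The supremum `Q` need not be attained. The `+ 1` keeps the denominator positive when `g Q = 0`.
  obtain ⟨I, hI⟩ := exists_lt_avgProd hw hQ1 hQ
    (show Q - ε / (8 * g Q + 1) < Q by
      have : (0 : ℝ) < ε / (8 * g Q + 1) := by positivity
      linarith)
  have h1 := integral_tangent_le hg (hm I) hQm
  have h2 : 8 * (g Q * (Q - D.avgProd w I)) ≤ ε := by
    have h3 : (8 * g Q + 1) * (Q - D.avgProd w I) ≤ ε := by
      rw [← le_div_iff₀' (by positivity)]
      linarith
    nlinarith [(hm I).2]
  calc ENNReal.ofReal (8 * G Q) ≤ ENNReal.ofReal (8 * G (D.avgProd w I) + ε) := by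
        apply ENNReal.ofReal_le_ofReal
        simp only [hG]
        linarith
    _ ≤ ENNReal.ofReal (8 * G (D.avgProd w I)) + ENNReal.ofReal ε := ENNReal.ofReal_add_le
    _ ≤ D.carlesonNorm (D.cSeq Φ w) + ε := by
        rw [ENNReal.ofReal_coe_nnreal]
        gcongr
        exact hlow I

/-! ### Step weights -/

/-- The product of `n` factors `1 ± ε` whose signs are the last `n` binary digits of `k`. -/
def stepValue (ε : ℝ) : ℕ → ℤ → ℝ
  | 0, _ => 1
  | n + 1, k => stepValue ε n (k / 2) * (if k % 2 = 0 then 1 + ε else 1 - ε)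

lemma stepValue_leftHalf (ε : ℝ) (n : ℕ) (k : ℤ) :
    stepValue ε (n + 1) (2 * k) = stepValue ε n k * (1 + ε) := by
  rw [stepValue, if_pos (by omega), show 2 * k / 2 = k by omega]

lemma stepValue_rightHalf (ε : ℝ) (n : ℕ) (k : ℤ) :
    stepValue ε (n + 1) (2 * k + 1) = stepValue ε n k * (1 - ε) := by
  rw [stepValue, if_neg (by omega), show (2 * k + 1) / 2 = k by omega]

/-- Each level contributes `(1 + ε)(1 - ε)` whatever the digit. So the reciprocal of a step weight
is a multiple of the step weight for `-ε`. -/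
lemma stepValue_mul_neg (ε : ℝ) (n : ℕ) (k : ℤ) :
    stepValue ε n k * stepValue (-ε) n k = (1 - ε ^ 2) ^ n := by
  induction n generalizing k with
  | zero => simp [stepValue]
  | succ n ih =>
    rw [stepValue, stepValue, mul_mul_mul_comm, ih, pow_succ]
    split_ifs <;> ring

lemma stepValue_pos {ε : ℝ} (h1 : -1 < ε) (h2 : ε < 1) (n : ℕ) (k : ℤ) :
    0 < stepValue ε n k := by
  induction n generalizing k with
  | zero => exact one_pos
  | succ n ih =>
    rw [stepValue]
    refine mul_pos (ih _) ?_
    split_ifs <;> linarith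

lemma stepValue_le {ε : ℝ} (h1 : -1 < ε) (h2 : ε < 1) (n : ℕ) (k : ℤ) :
    stepValue ε n k ≤ 2 ^ n := by
  induction n generalizing k with
  | zero => exact le_rfl
  | succ n ih =>
    rw [stepValue, pow_succ]
    refine mul_le_mul (ih _) ?_ ?_ (by positivity) <;> split_ifs <;> linarith

/-- The weight that has the value `stepValue ε N k` on the interval `(N, k)`. -/
noncomputable def stepWeight (ε : ℝ) (N : ℕ) (x : ℝ) : ℝ := stepValue ε N (D.position N x)

section StepWeight

variable {ε : ℝ} (h1 : -1 < ε) (h2 : ε < 1)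
include h1 h2

lemma stepWeight_pos (N : ℕ) (x : ℝ) : 0 < D.stepWeight ε N x := stepValue_pos h1 h2 _ _

lemma integrableOn_stepWeight (N : ℕ) (J : DyadicIndex) :
    IntegrableOn (D.stepWeight ε N) (D.interval J) := by
  refine Measure.integrableOn_of_bounded (M := 2 ^ N) (D.volume_interval_ne_top J)
    ((Measurable.of_discrete (f := stepValue ε N)).comp
      (D.measurable_position N)).aestronglyMeasurable (Eventually.of_forall fun x => ?_)
  rw [Real.norm_eq_abs, abs_of_pos (D.stepWeight_pos h1 h2 N x)]
  exact stepValue_le h1 h2 _ _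

lemma isWeight_stepWeight (N : ℕ) : IsWeight (D.stepWeight ε N) :=
  ⟨D.locallyIntegrable_of_interval (D.integrableOn_stepWeight h1 h2 N),
    Eventually.of_forall (D.stepWeight_pos h1 h2 N)⟩

lemma avg_stepWeight_add (n d : ℕ) (k : ℤ) :
    D.avg (D.stepWeight ε (n + d)) (n, k) = stepValue ε n k := by
  induction d generalizing n k with
  | zero =>
    refine D.avg_of_eqOn fun x hx => ?_
    rw [mem_interval_iff] at hx
    rw [stepWeight, add_zero, hx]
  | succ d ih =>
    rw [D.avg_eq_halves (D.integrableOn_stepWeight h1 h2 _ _)]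
    have e : n + (d + 1) = n + 1 + d := by ring
    have ih' := fun k => ih (n + 1) k
    push_cast at ih'
    rw [leftHalf, rightHalf, e, ih', ih', stepValue_leftHalf, stepValue_rightHalf]
    ring

lemma avg_stepWeight {n N : ℕ} (h : n ≤ N) (k : ℤ) :
    D.avg (D.stepWeight ε N) (n, k) = stepValue ε n k := by
  obtain ⟨d, rfl⟩ := Nat.exists_eq_add_of_le h
  exact D.avg_stepWeight_add h1 h2 n d k

/-- The pattern repeats with mean `1` on every interval of generation `0`, so no jump occurs above
that generation. -/
lemma avg_stepWeight_of_nonpos (N m : ℕ) (k : ℤ) :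
    D.avg (D.stepWeight ε N) (-(m : ℤ), k) = 1 := by
  induction m generalizing k with
  | zero => simpa [stepValue] using D.avg_stepWeight h1 h2 (Nat.zero_le N) k
  | succ m ih =>
    rw [D.avg_eq_halves (D.integrableOn_stepWeight h1 h2 _ _)]
    have e : -((m + 1 : ℕ) : ℤ) + 1 = -(m : ℤ) := by push_cast; ring
    rw [leftHalf, rightHalf, e, ih, ih]
    norm_num

omit h1 h2 in
-- The index `l` is independent of `δ`, so that the same one serves both `ε` and `-ε`.
lemma exists_stepWeight_eq (N d : ℕ) (k : ℤ) :
    ∃ l, ∀ δ : ℝ, ∀ x ∈ D.interval ((N + d : ℕ), k), D.stepWeight δ N x = stepValue δ N l := by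
  induction d generalizing k with
  | zero =>
    refine ⟨k, fun δ x hx => ?_⟩
    rw [add_zero, mem_interval_iff] at hx
    rw [stepWeight, hx]
  | succ d ih =>
    obtain ⟨l, hl⟩ := ih (k / 2)
    refine ⟨l, fun δ x hx => hl δ x ?_⟩
    have e : ((N + (d + 1) : ℕ) : ℤ) = ((N + d : ℕ) : ℤ) + 1 := by push_cast; ring
    rw [e] at hx
    rcases eq_half ((N + d : ℕ) : ℤ) k with h | h <;> rw [h] at hx
    · exact D.leftHalf_subset _ hx
    · exact D.rightHalf_subset _ hx

lemma inv_stepWeight {Q : ℝ} {N : ℕ} (hQ : Q * (1 - ε ^ 2) ^ N = 1) :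
    (fun x => (D.stepWeight ε N x)⁻¹) = fun x => Q * D.stepWeight (-ε) N x := by
  funext x
  have h := stepValue_mul_neg ε N (D.position N x)
  have h3 := D.stepWeight_pos h1 h2 N x
  rw [inv_eq_iff_eq_inv]
  refine eq_inv_of_mul_eq_one_left ?_
  rw [stepWeight, stepWeight]
  rw [← h] at hQ
  linarith

omit h1 h2 in
lemma avg_const_mul (Q : ℝ) (g : ℝ → ℝ) (J : DyadicIndex) :
    D.avg (fun x => Q * g x) J = Q * D.avg g J := by
  rw [avg_eq, avg_eq, integral_const_mul, mul_div_assoc]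

lemma avgProd_stepWeight {Q : ℝ} {n N : ℕ} (hQ : Q * (1 - ε ^ 2) ^ N = 1) (h : n ≤ N) (k : ℤ) :
    D.avgProd (D.stepWeight ε N) (n, k) = Q * (1 - ε ^ 2) ^ n := by
  rw [avgProd, D.inv_stepWeight h1 h2 hQ, avg_const_mul, D.avg_stepWeight h1 h2 h,
    D.avg_stepWeight (neg_lt_neg h2) (by linarith) h, ← stepValue_mul_neg ε n k]
  ring

lemma avgProd_stepWeight_of_nonpos {Q : ℝ} {N : ℕ} (hQ : Q * (1 - ε ^ 2) ^ N = 1) (m : ℕ)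
    (k : ℤ) : D.avgProd (D.stepWeight ε N) (-(m : ℤ), k) = Q := by
  rw [avgProd, D.inv_stepWeight h1 h2 hQ, avg_const_mul, D.avg_stepWeight_of_nonpos h1 h2,
    D.avg_stepWeight_of_nonpos (neg_lt_neg h2) (by linarith)]
  ring

lemma avgProd_stepWeight_of_ge {Q : ℝ} {N : ℕ} (hQ : Q * (1 - ε ^ 2) ^ N = 1) (d : ℕ)
    (k : ℤ) : D.avgProd (D.stepWeight ε N) ((N + d : ℕ), k) = 1 := by
  obtain ⟨l, hl⟩ := D.exists_stepWeight_eq N d k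
  rw [avgProd, D.inv_stepWeight h1 h2 hQ, avg_const_mul, D.avg_of_eqOn (hl ε),
    D.avg_of_eqOn (hl (-ε)), ← hQ, ← stepValue_mul_neg ε N l]
  ring

omit h1 h2 in
lemma generation_cases (N : ℕ) (n : ℤ) :
    (∃ m : ℕ, n = -((m + 1 : ℕ) : ℤ)) ∨ (∃ m : ℕ, m < N ∧ n = m) ∨
      ∃ d : ℕ, n = (N + d : ℕ) := by
  rcases lt_or_ge n 0 with h | h
  · exact Or.inl ⟨(-n - 1).toNat, by omega⟩
  · rcases lt_or_ge n N with h' | h'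
    · exact Or.inr (Or.inl ⟨n.toNat, by omega, by omega⟩)
    · exact Or.inr (Or.inr ⟨(n - N).toNat, by omega⟩)

lemma a2Char_stepWeight {Q : ℝ} {N : ℕ} (hQ : Q * (1 - ε ^ 2) ^ N = 1) :
    D.a2Char (D.stepWeight ε N) = ENNReal.ofReal Q := by
  have hε : ε ^ 2 < 1 := by nlinarith
  have hε0 := sq_nonneg ε
  have hQ1 : 1 ≤ Q := by
    have h3 : (1 - ε ^ 2) ^ N ≤ 1 := pow_le_one₀ (by linarith) (by linarith)
    have h4 : 0 < (1 - ε ^ 2) ^ N := pow_pos (by linarith) N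
    by_contra! h
    nlinarith
  have key : ∀ J, D.lavg (D.stepWeight ε N) J * D.lavg (fun x => (D.stepWeight ε N x)⁻¹) J =
      ENNReal.ofReal (D.avgProd (D.stepWeight ε N) J) := by
    intro J
    have hi := D.integrableOn_stepWeight h1 h2 N J
    have hp := D.isWeight_stepWeight h1 h2 N
    rw [D.lavg_eq_ofReal_avg hi (hp.2.mono fun x hx => hx.le),
      D.lavg_eq_ofReal_avg _ ((inv_pos_ae hp).mono fun x hx => hx.le),
      ← ENNReal.ofReal_mul (D.avg_pos hi hp.2).le, avgProd]
    rw [D.inv_stepWeight h1 h2 hQ]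
    exact (D.integrableOn_stepWeight (neg_lt_neg h2) (by linarith) N J).const_mul Q
  rw [a2Char]
  simp only [key]
  refine le_antisymm (iSup_le fun ⟨n, k⟩ => ENNReal.ofReal_le_ofReal ?_) ?_
  · rcases generation_cases N n with ⟨m, rfl⟩ | ⟨m, hm, rfl⟩ | ⟨d, rfl⟩
    · rw [D.avgProd_stepWeight_of_nonpos h1 h2 hQ]
    · rw [D.avgProd_stepWeight h1 h2 hQ hm.le]
      exact mul_le_of_le_one_right (by linarith) (pow_le_one₀ (by linarith) (by linarith))
    · rwa [D.avgProd_stepWeight_of_ge h1 h2 hQ]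
  · refine le_trans (le_of_eq ?_) (le_iSup _ ((0 : ℤ), (0 : ℤ)))
    rw [← D.avgProd_stepWeight_of_nonpos h1 h2 hQ 0 0]
    rfl

/-- The values of `c_J^Φ / |J|` for a step weight. -/
lemma cSeq_stepWeight (Φ : ℝ → ℝ) {Q : ℝ} {N : ℕ} (hQ : Q * (1 - ε ^ 2) ^ N = 1)
    (n k : ℤ) :
    D.cSeq Φ (D.stepWeight ε N) (n, k) = D.length (n, k) *
      if 0 ≤ n ∧ n < N then 8 * ε ^ 2 * Φ (Q * (1 - ε ^ 2) ^ n.toNat) else 0 := by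
  have h1' : -1 < -ε := neg_lt_neg h2
  have h2' : -ε < 1 := by linarith
  have hQ0 : Q ≠ 0 := by rintro rfl; simp at hQ
  have hinv := D.inv_stepWeight h1 h2 hQ
  rcases generation_cases N n with ⟨m, rfl⟩ | ⟨m, hm, rfl⟩ | ⟨d, rfl⟩
  · have e : -((m + 1 : ℕ) : ℤ) + 1 = -(m : ℤ) := by push_cast; ring
    rw [if_neg (by omega), cSeq, hinv]
    simp only [diff, avg_const_mul, leftHalf, rightHalf, e,
      D.avg_stepWeight_of_nonpos h1 h2, D.avg_stepWeight_of_nonpos h1' h2']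
    ring
  · have hp := D.avgProd_stepWeight h1 h2 hQ hm.le k
    have hv := stepValue_pos h1 h2 m k
    have hv' := stepValue_pos h1' h2' m k
    have a1 := fun k => D.avg_stepWeight h1 h2 (Nat.succ_le_of_lt hm) k
    have a2 := fun k => D.avg_stepWeight h1' h2' (Nat.succ_le_of_lt hm) k
    push_cast at a1 a2
    rw [avgProd] at hp
    rw [if_pos (by omega), cSeq, hp, hinv]
    simp only [diff, avg_const_mul, leftHalf, rightHalf, a1, a2, D.avg_stepWeight h1 h2 hm.le,
      D.avg_stepWeight h1' h2' hm.le, stepValue_leftHalf, stepValue_rightHalf, Int.toNat_natCast]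
    -- The relative jumps of `w` and `w⁻¹` are `2ε` and `-2ε`; their squares add up to `8ε²`.
    field_simp
    ring
  · obtain ⟨l, hl⟩ := D.exists_stepWeight_eq N d k
    have a : ∀ δ, D.diff (D.stepWeight δ N) ((N + d : ℕ), k) = 0 := fun δ => by
      rw [diff, D.avg_of_eqOn fun x hx => hl δ x (D.leftHalf_subset _ hx),
        D.avg_of_eqOn fun x hx => hl δ x (D.rightHalf_subset _ hx), sub_self]
    have b : D.diff (fun x => Q * D.stepWeight (-ε) N x) ((N + d : ℕ), k) = 0 := by
      rw [diff, avg_const_mul, avg_const_mul, ← mul_sub, ← diff, a, mul_zero]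
    rw [if_neg (by omega), cSeq, hinv, a, b]
    ring

end StepWeight

/-! ### Carleson norms of sequences that depend only on the generation -/

lemma tsum_length_le (I : DyadicIndex) (n : ℤ) :
    ∑' k : ℤ, (D.sub I).indicator (fun J => ENNReal.ofReal (D.length J)) (n, k) ≤
      ENNReal.ofReal (D.length I) := by
  set S : Set ℤ := {k | (n, k) ∈ D.sub I}
  have h : ∀ k : ℤ, (D.sub I).indicator (fun J => ENNReal.ofReal (D.length J)) (n, k) =
      S.indicator (fun k => volume (D.interval (n, k))) k := fun k => by
    by_cases hk : (n, k) ∈ D.sub I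
    · rw [indicator_of_mem hk, indicator_of_mem (show k ∈ S from hk), volume_interval]
    · rw [indicator_of_notMem hk, indicator_of_notMem (show k ∉ S from hk)]
  simp only [h]
  rw [← tsum_subtype, ← volume_interval, ← measure_iUnion
    (fun k l hkl => D.disjoint_interval n fun h => hkl (Subtype.ext h))
    fun k => D.measurableSet_interval _]
  exact measure_mono (iUnion_subset fun k => k.2)

/-- The intervals of one generation inside `I` are disjoint, so generation `n` contributes at most
`C n` times `|I|`. -/
lemma carlesonNorm_le_tsum {c : DyadicIndex → ℝ} {C : ℤ → ℝ}
    (hc : ∀ n k, c (n, k) = D.length (n, k) * C n) :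
    D.carlesonNorm c ≤ ∑' n, ENNReal.ofReal (C n) := by
  refine iSup_le fun I => ENNReal.div_le_of_le_mul ?_
  rw [tsum_subtype (D.sub I) (fun J => ENNReal.ofReal (c J)), ENNReal.tsum_prod',
    ← ENNReal.tsum_mul_right]
  refine ENNReal.tsum_le_tsum fun n => ?_
  have h : ∀ k, (D.sub I).indicator (fun J => ENNReal.ofReal (c J)) (n, k) =
      ENNReal.ofReal (C n) * (D.sub I).indicator (fun J => ENNReal.ofReal (D.length J)) (n, k) := by
    intro k
    by_cases hk : (n, k) ∈ D.sub I
    · rw [indicator_of_mem hk, indicator_of_mem hk, hc, mul_comm,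
        ENNReal.ofReal_mul' (D.length_pos _).le]
    · rw [indicator_of_notMem hk, indicator_of_notMem hk, mul_zero]
  simp only [h]
  rw [ENNReal.tsum_mul_left]
  gcongr
  exact D.tsum_length_le I n

/-! ### The upper bound -/

lemma lowerCarleson_le_sum {Φ : ℝ → ℝ} (hΦ : ∀ t, 1 ≤ t → 0 ≤ Φ t) {ε Q : ℝ} {N : ℕ}
    (h1 : -1 < ε) (h2 : ε < 1) (hQ : Q * (1 - ε ^ 2) ^ N = 1) :
    lowerCarleson D Φ Q ≤ ENNReal.ofReal
      (∑ n ∈ Finset.range N, 8 * ε ^ 2 * Φ (Q * (1 - ε ^ 2) ^ n)) := by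
  have hε : ε ^ 2 < 1 := by nlinarith
  have hge : ∀ n < N, 1 ≤ Q * (1 - ε ^ 2) ^ n := fun n hn => by
    have hp : 0 < (1 - ε ^ 2) ^ N := pow_pos (by linarith) N
    refine hQ.symm.le.trans (mul_le_mul_of_nonneg_left
      (pow_le_pow_of_le_one (by linarith) (by linarith [sq_nonneg ε]) hn.le) ?_)
    by_contra! h
    nlinarith
  refine (iInf₂_le_of_le (D.stepWeight ε N) (D.isWeight_stepWeight h1 h2 N)
    (iInf_le _ (D.a2Char_stepWeight h1 h2 hQ))).trans ?_
  refine (D.carlesonNorm_le_tsum (D.cSeq_stepWeight h1 h2 Φ hQ)).trans (le_of_eq ?_)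
  rw [tsum_eq_sum (s := (Finset.range N).map Nat.castEmbedding), Finset.sum_map,
    ENNReal.ofReal_sum_of_nonneg]
  · refine Finset.sum_congr rfl fun n hn => ?_
    rw [Finset.mem_range] at hn
    simp [hn]
  · intro n hn
    have := hΦ _ (hge n (Finset.mem_range.1 hn))
    positivity
  · intro n hn
    rw [if_neg, ENNReal.ofReal_zero]
    rintro ⟨h3, h4⟩
    apply hn
    simp only [Finset.mem_map, Finset.mem_range]
    exact ⟨n.toNat, by omega, by simp [h3]⟩

/-- The error of the upper Riemann sum of an increasing function. -/
lemma sum_mul_sub_le {g : ℝ → ℝ} {Q δ : ℝ} {t : ℕ → ℝ} {N : ℕ} (hg : MonotoneOn g (Icc 1 Q))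
    (ht : ∀ n ≤ N, t n ∈ Icc 1 Q) (h0 : ∀ n < N, t (n + 1) ≤ t n)
    (hδ : ∀ n < N, t n - t (n + 1) ≤ δ) {m : ℕ} (hm : m ≤ N) :
    ∑ n ∈ Finset.range m, g (t n) * (t n - t (n + 1)) ≤
      (∫ y in (1 : ℝ)..t 0, g y) - (∫ y in (1 : ℝ)..t m, g y) + δ * (g (t 0) - g (t m)) := by
  induction m with
  | zero => simp
  | succ m ih =>
    rw [Finset.sum_range_succ]
    have h1 := ih (by omega)
    have h2 := integral_tangent_le hg (ht m (by omega)) (ht (m + 1) hm)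
    have h3 := hg (ht (m + 1) hm) (ht m (by omega)) (h0 m hm)
    -- The gap between the upper and lower rectangles is at most `δ (g (t m) - g (t (m + 1)))`,
    -- which telescopes.
    nlinarith [mul_le_mul_of_nonneg_right (hδ m hm) (sub_nonneg.2 h3)]

lemma lowerCarleson_le_integral {Φ : ℝ → ℝ} (hΦ : ∀ t, 1 ≤ t → 0 ≤ Φ t) {Q : ℝ} (hQ1 : 1 ≤ Q)
    (hg : MonotoneOn (fun t => Φ t / t) (Icc 1 Q)) :
    lowerCarleson D Φ Q ≤ ENNReal.ofReal (8 * ∫ y in (1 : ℝ)..Q, Φ y / y) := by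
  -- `ρ N` is the value of `1 - ε²` for which `N + 1` levels bring the product from `Q` down to `1`.
  set ρ : ℕ → ℝ := fun N => Q ^ (-((N : ℝ) + 1)⁻¹) with hρdef
  have hQ0 : 0 < Q := by linarith
  have hρ0 : ∀ N, 0 < ρ N := fun N => Real.rpow_pos_of_pos hQ0 _
  have hρ1 : ∀ N, ρ N ≤ 1 := fun N =>
    Real.rpow_le_one_of_one_le_of_nonpos hQ1 (neg_nonpos.2 (by positivity))
  have hρN : ∀ N, Q * ρ N ^ (N + 1) = 1 := fun N => by
    have h : (-((N : ℝ) + 1)⁻¹) * ((N + 1 : ℕ) : ℝ) = -1 := by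
      push_cast
      field_simp
    rw [hρdef, ← Real.rpow_mul_natCast hQ0.le, h, Real.rpow_neg_one, mul_inv_cancel₀ hQ0.ne']
  have hlim : Tendsto ρ atTop (𝓝 1) := by
    have h : Tendsto (fun N : ℕ => -((N : ℝ) + 1)⁻¹) atTop (𝓝 0) := by
      simpa using (tendsto_one_div_add_atTop_nhds_zero_nat (𝕜 := ℝ)).neg
    simpa using (tendsto_const_nhds (x := Q)).rpow h (Or.inl hQ0.ne')
  have hlim2 : Tendsto (fun N => ENNReal.ofReal (8 * ((∫ y in (1 : ℝ)..Q, Φ y / y) +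
      Q * (1 - ρ N) * (Φ Q / Q - Φ 1 / 1)))) atTop
      (𝓝 (ENNReal.ofReal (8 * ∫ y in (1 : ℝ)..Q, Φ y / y))) := by
    refine ENNReal.tendsto_ofReal ?_
    simpa using ((((hlim.const_sub 1).const_mul Q).mul_const (Φ Q / Q - Φ 1 / 1)).const_add
      (∫ y in (1 : ℝ)..Q, Φ y / y)).const_mul 8
  refine ge_of_tendsto' hlim2 fun N => ?_
  have hε : √(1 - ρ N) ^ 2 = 1 - ρ N := Real.sq_sqrt (by linarith [hρ1 N])
  have hε2 : 1 - √(1 - ρ N) ^ 2 = ρ N := by linarith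
  have hup := D.lowerCarleson_le_sum hΦ (ε := √(1 - ρ N)) (Q := Q) (N := N + 1)
    (by linarith [Real.sqrt_nonneg (1 - ρ N)])
    (by rw [Real.sqrt_lt' one_pos]; linarith [hρ0 N]) (by rw [hε2, hρN])
  refine hup.trans (ENNReal.ofReal_le_ofReal ?_)
  rw [hε2, hε]
  have htm : ∀ n ≤ N + 1, Q * ρ N ^ n ∈ Icc 1 Q := fun n hn => by
    refine ⟨?_, mul_le_of_le_one_right hQ0.le (pow_le_one₀ (hρ0 N).le (hρ1 N))⟩
    rw [← hρN N]
    exact mul_le_mul_of_nonneg_left (pow_le_pow_of_le_one (hρ0 N).le (hρ1 N) hn) hQ0.le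
  -- With `t_n = Q ρⁿ` this reads `t_n - t_{n+1} = ε² t_n`. Hence `ε² Φ(t_n) = (Φ(t_n)/t_n)(t_n -
  -- t_{n+1})` is a Riemann term, and the mesh is at most `Q (1 - ρ) → 0`.
  have hd : ∀ n, Q * ρ N ^ n - Q * ρ N ^ (n + 1) = (1 - ρ N) * (Q * ρ N ^ n) := fun n => by ring
  have hsum := sum_mul_sub_le (t := fun n => Q * ρ N ^ n) (δ := Q * (1 - ρ N)) hg htm
    (fun n hn => by
      have := mul_nonneg (sub_nonneg.2 (hρ1 N)) (zero_le_one.trans (htm n hn.le).1)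
      linarith [hd n])
    (fun n hn => by
      have := mul_le_mul_of_nonneg_left (htm n hn.le).2 (sub_nonneg.2 (hρ1 N))
      linarith [hd n]) le_rfl
  simp only [hρN, pow_zero, mul_one, intervalIntegral.integral_same, sub_zero] at hsum
  refine le_trans (le_of_eq ?_) (mul_le_mul_of_nonneg_left hsum (by norm_num : (0 : ℝ) ≤ 8))
  rw [Finset.mul_sum]
  refine Finset.sum_congr rfl fun n hn => ?_
  have : Q * ρ N ^ n ≠ 0 := (mul_pos hQ0 (pow_pos (hρ0 N) n)).ne'
  rw [hd, mul_comm (1 - ρ N), ← mul_assoc (Φ (Q * ρ N ^ n) / _), div_mul_cancel₀ _ this]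
  ring

end DyadicLattice

/-! ### Monotonicity of `h` as monotonicity of `Φ(t)/t`, and the two cases -/

lemma hFun_sqrt (Φ : ℝ → ℝ) {t : ℝ} (ht : 1 ≤ t) : hFun Φ √t = Φ t / t := by
  rw [hFun, Real.sq_sqrt (by linarith)]

theorem theorem2p3 (D : DyadicLattice) (Φ : ℝ → ℝ) (hΦ : ∀ t : ℝ, 1 ≤ t → 0 ≤ Φ t) :
    (MonotoneOn (hFun Φ) (Ici 1) →
      ∀ Q : ℝ, 1 ≤ Q →
        lowerCarleson D Φ Q = ENNReal.ofReal (8 * ∫ y in (1 : ℝ)..Q, Φ y / y)) ∧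
    (AntitoneOn (hFun Φ) (Ici 1) →
      ∀ Q : ℝ, 1 ≤ Q →
        lowerCarleson D Φ Q = ENNReal.ofReal (8 * Φ Q * (1 - 1 / Q))) := by
  have hs : ∀ {t : ℝ}, 1 ≤ t → √t ∈ Ici 1 := fun ht => Real.one_le_sqrt.2 ht
  constructor
  · intro hmono Q hQ1
    have hg : MonotoneOn (fun t => Φ t / t) (Icc 1 Q) := fun s hs1 t ht1 hst => by
      simp only
      rw [← hFun_sqrt Φ hs1.1, ← hFun_sqrt Φ ht1.1]
      exact hmono (hs hs1.1) (hs ht1.1) (Real.sqrt_le_sqrt hst)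
    refine le_antisymm (D.lowerCarleson_le_integral hΦ hQ1 hg) ?_
    refine le_iInf fun w => le_iInf₂ fun hw hQ =>
      D.ofReal_integral_le_carlesonNorm hQ1 hΦ hg (fun t ht => ?_) (fun t ht => ?_) hw hQ
    · exact div_nonneg (hΦ t ht.1) (by linarith [ht.1])
    · rw [div_mul_cancel₀ _ (by linarith [ht.1])]
  · intro hanti Q hQ1
    have hQ0 : 0 < Q := by linarith
    refine le_antisymm ?_ ?_
    · have hle : 1 / Q ≤ 1 := by rw [div_le_one hQ0]; exact hQ1
      have hpos : 0 < 1 / Q := by positivity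
      have hε : √(1 - 1 / Q) ^ 2 = 1 - 1 / Q := Real.sq_sqrt (by linarith)
      -- A single level, with `1 - ε² = 1/Q`, drops the product from `Q` to `1` at once, so `Φ` is
      -- evaluated only at `Q`.
      have := D.lowerCarleson_le_sum hΦ (ε := √(1 - 1 / Q)) (Q := Q) (N := 1)
        (by linarith [Real.sqrt_nonneg (1 - 1 / Q)])
        (by rw [Real.sqrt_lt' one_pos]; linarith) (by rw [hε]; field_simp; ring)
      refine this.trans (ENNReal.ofReal_le_ofReal (le_of_eq ?_))
      rw [Finset.sum_range_one, pow_zero, mul_one, hε]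
      ring
    · refine le_iInf fun w => le_iInf₂ fun hw hQ => ?_
      -- As `Φ(t)/t` decreases, its minimum `Φ(Q)/Q` on `[1, Q]` is an admissible constant `g`.
      have := D.ofReal_integral_le_carlesonNorm (g := fun _ => Φ Q / Q) hQ1 hΦ monotoneOn_const
        (fun t _ => div_nonneg (hΦ Q hQ1) hQ0.le) (fun t ht => ?_) hw hQ
      · rw [intervalIntegral.integral_const, smul_eq_mul] at this
        refine le_trans (le_of_eq ?_) this
        congr 1
        field_simp
      · rw [← le_div_iff₀ (by linarith [ht.1]), ← hFun_sqrt Φ hQ1, ← hFun_sqrt Φ ht.1]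
        exact hanti (hs ht.1) (hs hQ1) (Real.sqrt_le_sqrt ht.2)
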